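/- Let $k\ge 2$ and let ${\bf x}=a_0a_1a_2\cdots$ be a $k$-automatic sequence over a linearly ordered alphabet, i.e. there is a deterministic finite automaton with output that, on reading any base-$k$ representation of $n$ (most significant digit first), outputs $a_n$, for every $n\ge 0$. Words are compared lexicographically, a proper prefix being smaller. A finite word is Lyndon if it is nonempty, not of the form $u^m$ with $m\ge 2$, and least among its conjugates (cyclic shifts); an infinite word is Lyndon if it is strictly less than each of its proper suffixes. A Lyndon factorization of ${\bf x}$ is a factorization either (a) ${\bf x}=w_1w_2w_3\cdots$ with every $w_i$ a finite Lyndon word and $w_1\ge w_2\ge w_3\ge\cdots$, or (b) ${\bf x}=w_1w_2\cdots w_r{\bf w}$ with $r\ge 0$, every $w_i$ a finite Lyndon word, ${\bf w}$ an infinite Lyndon word, and $w_1\ge w_2\ge\cdots\ge w_r\ge{\bf w}$. Then ${\bf x}$ has exactly one Lyndon factorization, of exactly one of the two kinds, and the infinite word over $\{0,1\}$ whose $1$'s are exactly at the positions $|w_1w_2\cdots w_i|$ at which a term of the factorization begins ($i\ge 0$ in case (a); $0\le i\le r$ in case (b), so that the start of ${\bf w}$ is included) is $k$-automatic. -/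

import Mathlib

/-- A deterministic finite automaton with output, over the base-`k` digits, with states `σ`
and outputs in `A`. (Finiteness of `σ` is required where the structure is used.) -/
structure DFAO (k : ℕ) (σ : Type) (A : Type*) where
  step : σ → Fin k → σ
  start : σ
  output : σ → A

/-- The output of the automaton after reading the word `w` from left to right. -/
def DFAO.run {k : ℕ} {σ : Type} {A : Type*} (M : DFAO k σ A) (w : List (Fin k)) : A :=
  M.output (w.foldl M.step M.start)

/-- The integer represented in base `k` by `w`, most significant digit first. -/
def baseValue (k : ℕ) (w : List (Fin k)) : ℕ :=
  Nat.ofDigits k (w.map Fin.val).reverse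

/-- `x` is `k`-automatic: some finite automaton with output yields `x n` on every
base-`k` representation of `n` (most significant digit first). -/
def IsAutomatic (k : ℕ) {A : Type*} (x : ℕ → A) : Prop :=
  ∃ (σ : Type) (_ : Finite σ) (M : DFAO k σ A),
    ∀ (n : ℕ) (w : List (Fin k)), baseValue k w = n → M.run w = x n

/-- A nonempty word that is not of the form `u ^ n` with `n ≥ 2`. -/
def IsPrimitiveWord {A : Type*} (w : List A) : Prop :=
  w ≠ [] ∧ ∀ (u : List A) (n : ℕ), 2 ≤ n → w ≠ (List.replicate n u).flatten

/-- A finite word is Lyndon if it is primitive and lexicographically least among its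
conjugates (cyclic rotations). The order on `List A` is the lexicographic one, in which a proper
prefix of a word is smaller than the word. -/
def IsLyndonWord {A : Type*} [LinearOrder A] (w : List A) : Prop :=
  IsPrimitiveWord w ∧ ∀ c : List A, List.IsRotated w c → w ≤ c

/-- An infinite word is Lyndon if it is lexicographically less than all its suffixes starting
at positions `j ≥ 1`. -/
def IsInfiniteLyndonWord {A : Type*} [LinearOrder A] (x : ℕ → A) : Prop :=
  ∀ j : ℕ, 1 ≤ j → toLex x < toLex (fun n => x (j + n))

/-- The infinite word `y` is lexicographically less than the finite word `u`: they differ at some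
position of `u`, and at the first such position `y` has the smaller letter.
(If they do not differ, then `u` is a proper prefix of `y`, hence less than `y`.) -/
def InfiniteWordLT {A : Type*} [LinearOrder A] (y : ℕ → A) (u : List A) : Prop :=
  ∃ (t : ℕ) (ht : t < u.length), (∀ (s : ℕ) (hs : s < t), y s = u[s]) ∧ y t < u[t]

/-- The data of a factorization of an infinite word: either an infinite sequence of finite
words, or a finite list of finite words followed by one infinite word. -/
inductive Factorization (A : Type*) where
  | infinite (w : ℕ → List A)
  | finite (ws : List (List A)) (y : ℕ → A)

/-- `F` is a Lyndon factorization of `x`. -/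
def Factorization.IsLyndonOf {A : Type*} [LinearOrder A] (x : ℕ → A) : Factorization A → Prop
  | .infinite w =>
      (∀ i, IsLyndonWord (w i)) ∧
      (∀ i, w (i + 1) ≤ w i) ∧
      (∀ (n t : ℕ) (ht : t < (w n).length),
        x ((∑ i ∈ Finset.range n, (w i).length) + t) = (w n)[t])
  | .finite ws y =>
      (∀ u ∈ ws, IsLyndonWord u) ∧ IsInfiniteLyndonWord y ∧
      ws.Pairwise (fun u v => v ≤ u) ∧
      (∀ u ∈ ws, InfiniteWordLT y u) ∧
      (∀ (t : ℕ) (ht : t < ws.flatten.length), x t = ws.flatten[t]) ∧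
      (∀ t : ℕ, x (ws.flatten.length + t) = y t)

/-- The positions at which the terms of a factorization start (including, in the finite case,
the position at which the infinite term starts). -/
def Factorization.starts {A : Type*} : Factorization A → Set ℕ
  | .infinite w => {m | ∃ n : ℕ, m = ∑ i ∈ Finset.range n, (w i).length}
  | .finite ws _ => {m | ∃ n ≤ ws.length, m = (ws.take n).flatten.length}

open Classical in
/-- The encoding of a factorization as an infinite word over `{0, 1}`, with `1` exactly at the
positions where a term starts. -/
noncomputable def Factorization.encoding {A : Type*} (F : Factorization A) : ℕ → Fin 2 :=
  fun m => if m ∈ F.starts then 1 else 0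

/-! The starting positions of a Lyndon factorization depend only on the order of the suffixes of
`x`: they are exactly the records, the positions `m` whose suffix is at most every earlier suffix
(`IsLyndonCuts.mem_suffixRecords_iff`). Two factorizations therefore have the same starts, and so
coincide. Conversely, cutting `x` at its records always gives a Lyndon factorization
(`exists_isLyndonCuts`), with an infinite last term exactly when there are finitely many records.

Being a record is a first-order condition: no `j < m` has a `t` such that `x (j + s) = x (m + s)`
for all `s < t` while `x (j + t) < x (m + t)`. Predicates with a finite kernel in several variables
are closed under Boolean operations and quantification, and include `v i < v j` and those comparing
values `x (v i + v j)`. Hence the record predicate is automatic (`isAutomatic_suffixRecords`). -/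

/-! ### Automata and finite kernels in several variables -/

theorem baseValue_append_singleton {k : ℕ} (w : List (Fin k)) (c : Fin k) :
    baseValue k (w ++ [c]) = k * baseValue k w + c := by
  simp [baseValue, Nat.ofDigits_cons, add_comm]

theorem exists_baseValue_eq {k : ℕ} (hk : 2 ≤ k) (n : ℕ) : ∃ w : List (Fin k), baseValue k w = n := by
  induction n using Nat.strong_induction_on with
  | _ n ih =>
    rcases Nat.eq_zero_or_pos n with rfl | hn
    · exact ⟨[], by simp [baseValue]⟩
    · obtain ⟨w, hw⟩ := ih (n / k) (Nat.div_lt_self hn hk)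
      refine ⟨w ++ [⟨n % k, Nat.mod_lt _ (by omega)⟩], ?_⟩
      rw [baseValue_append_singleton, hw]
      exact Nat.div_add_mod n k

/-- `f` lies in a finite set of functions that is closed under appending base-`k` digits to all
the arguments. -/
def HasFiniteKernel (k : ℕ) {ι B : Type*} (f : (ι → ℕ) → B) : Prop :=
  ∃ K : Set ((ι → ℕ) → B), K.Finite ∧ f ∈ K ∧
    ∀ g ∈ K, ∀ c : ι → Fin k, (fun v => g fun i => k * v i + c i) ∈ K

theorem IsAutomatic.exists_kernel {k : ℕ} (hk : 2 ≤ k) {A : Type*} {x : ℕ → A}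
    (hx : IsAutomatic k x) :
    ∃ K : Set (ℕ → A), K.Finite ∧ x ∈ K ∧
      ∀ g ∈ K, ∀ c : Fin k, (fun n => g (k * n + c)) ∈ K := by
  obtain ⟨σ, _, M, hM⟩ := hx
  choose rep hrep using exists_baseValue_eq hk
  -- Here `h` is the action on states of digits still to be read; there are finitely many such maps,
  -- and each determines `g`.
  refine ⟨{g | ∃ h : σ → σ, ∀ w, M.output (h (w.foldl M.step M.start)) = g (baseValue k w)},
    ?_, ⟨id, fun w => hM _ w rfl⟩, ?_⟩
  · refine (Set.finite_range fun h : σ → σ => fun n =>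
      M.output (h ((rep n).foldl M.step M.start))).subset ?_
    rintro g ⟨h, hg⟩
    exact ⟨h, funext fun n => by simp only [hg, hrep]⟩
  · rintro g ⟨h, hg⟩ c
    refine ⟨fun s => h (M.step s c), fun w => ?_⟩
    simp only [← baseValue_append_singleton, ← hg]
    simp

/-- The state stores the values of all kernel elements at the number read so far. Reading `c`
replaces the value of `g` by that of its `c`-shift, again a kernel element. The start state holds
the values at `0`, so leading zeros are harmless. -/
theorem HasFiniteKernel.isAutomatic {k : ℕ} {ι : Type} {B : Type} [Finite B] {f : (ι → ℕ) → B}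
    (hf : HasFiniteKernel k f) : IsAutomatic k fun n => f fun _ => n := by
  obtain ⟨K, hK, hfK, hcl⟩ := hf
  have := hK.to_subtype
  refine ⟨K → B, inferInstance,
    ⟨fun s c g => s ⟨_, hcl g g.2 fun _ => c⟩, fun g => g.1 fun _ => 0, fun s => s ⟨f, hfK⟩⟩, ?_⟩
  rintro n w rfl
  suffices h : ∀ w : List (Fin k), w.foldl (fun (s : K → B) c (g : K) =>
      s ⟨_, hcl g g.2 fun _ => c⟩) (fun g => g.1 fun _ => 0) =
        fun g => g.1 fun _ => baseValue k w by
    simp [DFAO.run, h]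
  intro w
  induction w using List.reverseRecOn with
  | nil => simp [baseValue]
  | append_singleton w c ih =>
    rw [List.foldl_append, ih]
    simp [baseValue_append_singleton]

namespace HasFiniteKernel

variable {k : ℕ} {ι : Type*}

theorem comp {B C : Type*} {f : (ι → ℕ) → B} (hf : HasFiniteKernel k f) (φ : B → C) :
    HasFiniteKernel k fun v => φ (f v) := by
  obtain ⟨K, hK, hfK, hcl⟩ := hf
  refine ⟨(fun g v => φ (g v)) '' K, hK.image _, ⟨f, hfK, rfl⟩, ?_⟩
  rintro _ ⟨g, hg, rfl⟩ c
  exact ⟨_, hcl g hg c, rfl⟩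

theorem comp₂ {B C D : Type*} {f : (ι → ℕ) → B} {g : (ι → ℕ) → C} (hf : HasFiniteKernel k f)
    (hg : HasFiniteKernel k g) (φ : B → C → D) : HasFiniteKernel k fun v => φ (f v) (g v) := by
  obtain ⟨K, hK, hfK, hcl⟩ := hf
  obtain ⟨K', hK', hgK, hcl'⟩ := hg
  refine ⟨Set.image2 (fun f g v => φ (f v) (g v)) K K', hK.image2 _ hK', ⟨f, hfK, g, hgK, rfl⟩, ?_⟩
  rintro _ ⟨f, hf, g, hg, rfl⟩ c
  exact ⟨_, hcl f hf c, _, hcl' g hg c, rfl⟩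

/-- Subset construction: the last digit `d` of the witness is guessed, so one predicate becomes a
finite disjunction, recorded by a subset `T` of the kernel. -/
theorem exists_update [DecidableEq ι] (hk : 0 < k) {P : (ι → ℕ) → Prop}
    (hP : HasFiniteKernel k P) (i : ι) :
    HasFiniteKernel k fun v => ∃ t, P (Function.update v i t) := by
  obtain ⟨K, hK, hPK, hcl⟩ := hP
  refine ⟨(fun (T : Set ((ι → ℕ) → Prop)) v => ∃ t, ∃ Q ∈ T, Q (Function.update v i t)) ''
    K.powerset, hK.finite_subsets.image _, ⟨{P}, by simpa using hPK, by simp⟩, ?_⟩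
  rintro _ ⟨T, hT, rfl⟩ c
  refine ⟨{Q | ∃ R ∈ T, ∃ d : Fin k,
    Q = fun v => R fun j => k * v j + Function.update c i d j}, ?_, ?_⟩
  · rintro _ ⟨R, hR, d, rfl⟩
    exact hcl R (hT hR) _
  · have key : ∀ (v : ι → ℕ) (t : ℕ) (d : Fin k),
        (fun j => k * Function.update v i t j + (Function.update c i d j : Fin k)) =
          Function.update (fun j => k * v j + (c j : ℕ)) i (k * t + d) := by
      intro v t d
      ext j
      by_cases h : j = i
      · subst h; simp
      · simp [h]
    ext v
    constructor
    · rintro ⟨t, _, ⟨R, hR, d, rfl⟩, h⟩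
      exact ⟨k * t + d, R, hR, by simpa only [key] using h⟩
    · rintro ⟨t, R, hR, h⟩
      refine ⟨t / k, _, ⟨R, hR, ⟨t % k, Nat.mod_lt _ hk⟩, rfl⟩, ?_⟩
      simpa only [key, Nat.div_add_mod] using h

theorem forall_update [DecidableEq ι] (hk : 0 < k) {P : (ι → ℕ) → Prop}
    (hP : HasFiniteKernel k P) (i : ι) :
    HasFiniteKernel k fun v => ∀ t, P (Function.update v i t) := by
  simpa using ((hP.comp Not).exists_update hk i).comp Not

/-- Last digits `c < d` turn either comparison into `≤`, `c > d` turns it into `<`, and equal digits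
preserve it. -/
theorem lt (i j : ι) : HasFiniteKernel k fun v => v i < v j := by
  refine ⟨{fun v => v i < v j, fun v => v i ≤ v j}, by simp, by simp, ?_⟩
  have hlt : ∀ (a b : ℕ) (c d : Fin k), c < d → (k * a + c < k * b + d ↔ a ≤ b) := by
    intro a b c d h
    constructor
    · intro h'
      by_contra! hab
      have : k * (b + 1) ≤ k * a := Nat.mul_le_mul_left k hab
      have := d.2
      grind
    · intro hab
      have : k * a ≤ k * b := Nat.mul_le_mul_left k hab
      have : (c : ℕ) < d := h
      omega
  have hge : ∀ (a b : ℕ) (c d : Fin k), d ≤ c → (k * a + c < k * b + d ↔ a < b) := by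
    intro a b c d h
    rcases h.lt_or_eq with h | rfl
    · have := hlt b a d c h
      have : (d : ℕ) < c := h
      constructor
      · intro h'
        by_contra! hab
        have : k * b ≤ k * a := Nat.mul_le_mul_left k hab
        omega
      · intro hab
        have : k * (a + 1) ≤ k * b := Nat.mul_le_mul_left k hab
        have := c.2
        grind
    · simp [Nat.mul_lt_mul_left (show 0 < k from (Nat.zero_le _).trans_lt d.2)]
  rintro g (rfl | rfl) c
  · rcases lt_or_ge (c i) (c j) with h | h
    · exact Or.inr (funext fun v => propext (hlt _ _ _ _ h))
    · exact Or.inl (funext fun v => propext (hge _ _ _ _ h))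
  · rcases lt_or_ge (c j) (c i) with h | h
    · refine Or.inl (funext fun v => propext ?_)
      beta_reduce
      rw [← not_lt, hlt _ _ _ _ h, not_le]
    · refine Or.inr (funext fun v => propext ?_)
      beta_reduce
      rw [← not_lt, hge _ _ _ _ h, not_lt]

theorem of_add {A : Type*} (hk : 2 ≤ k) {x : ℕ → A} (hx : IsAutomatic k x) (i j : ι) :
    HasFiniteKernel k fun v => x (v i + v j) := by
  obtain ⟨K, hK, hxK, hcl⟩ := hx.exists_kernel hk
  -- The number `e` is the carry of the addition; it stays at most `1` because two digits and a
  -- carry sum to less than `2 * k`.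
  refine ⟨Set.image2 (fun y (e : ℕ) v => y (v i + v j + e)) K (Set.Iic 1),
    hK.image2 _ (Set.finite_Iic 1), ⟨x, hxK, 0, by simp, rfl⟩, ?_⟩
  rintro _ ⟨y, hy, e, he, rfl⟩ c
  have he : e ≤ 1 := he
  have hi := (c i).2
  have hj := (c j).2
  refine ⟨_, hcl y hy ⟨(c i + c j + e) % k, Nat.mod_lt _ (by omega)⟩, (c i + c j + e) / k, ?_, ?_⟩
  · exact Nat.lt_succ_iff.1 ((Nat.div_lt_iff_lt_mul (by omega)).2 (by omega))
  · funext v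
    have := Nat.div_add_mod (c i + c j + e : ℕ) k
    simp only [mul_add]
    congr 1
    omega

end HasFiniteKernel

/-! ### Suffix records and their automaticity -/

/-- Infinite words, ordered lexicographically. -/
def InfiniteWord (A : Type*) : Type _ := Lex (ℕ → A)

noncomputable instance {A : Type*} [LinearOrder A] : LinearOrder (InfiniteWord A) :=
  inferInstanceAs (LinearOrder (Lex (ℕ → A)))

/-- The suffix of `x` starting at position `m`. -/
def lexSuffix {A : Type*} (x : ℕ → A) (m : ℕ) : InfiniteWord A :=
  toLex fun n => x (m + n)

/-- The positions at which the suffix of `x` is minimal among the suffixes starting no later. -/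
def suffixRecords {A : Type*} [LinearOrder A] (x : ℕ → A) : Set ℕ :=
  {m | ∀ j < m, lexSuffix x m ≤ lexSuffix x j}

theorem lexSuffix_lt_iff {A : Type*} [LinearOrder A] {x : ℕ → A} {a b : ℕ} :
    lexSuffix x a < lexSuffix x b ↔
      ∃ t, (∀ s < t, x (a + s) = x (b + s)) ∧ x (a + t) < x (b + t) :=
  Iff.rfl

open Classical in
theorem isAutomatic_suffixRecords {A : Type*} [LinearOrder A] {k : ℕ} (hk : 2 ≤ k) {x : ℕ → A}
    (hx : IsAutomatic k x) :
    IsAutomatic k fun m => if m ∈ suffixRecords x then (1 : Fin 2) else 0 := by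
  have hk0 : 0 < k := by omega
  -- Variables: `0` is the position `m`, `1` the earlier position `j`, `2` the mismatch `t`, `3` the
  -- index `s < t`.
  have hadd (i j : Fin 4) := HasFiniteKernel.of_add hk hx i j
  have hagree := (((HasFiniteKernel.lt (3 : Fin 4) 2).comp₂
    ((hadd 1 3).comp₂ (hadd 0 3) (· = ·)) (· → ·)).forall_update hk0 3)
  have hless := (hagree.comp₂ ((hadd 1 2).comp₂ (hadd 0 2) (· < ·)) And).exists_update hk0 2
  have hrec := ((HasFiniteKernel.lt (1 : Fin 4) 0).comp₂ hless (fun p q => p → ¬ q)).forall_update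
    hk0 1
  have := (hrec.comp fun p => if p then (1 : Fin 2) else 0).isAutomatic
  refine (congrArg (IsAutomatic k) (funext fun m => if_congr ?_ rfl rfl)).mpr this
  simp only [suffixRecords, Set.mem_ofPred_eq, ← not_lt (a := lexSuffix x _),
    lexSuffix_lt_iff]
  exact Iff.rfl

/-! ### Primitive words, factors and a suffix criterion for Lyndon words -/

theorem List.exists_replicate_of_append_comm {A : Type*} (u v : List A) (h : u ++ v = v ++ u) :
    ∃ (z : List A) (a b : ℕ), u = (List.replicate a z).flatten ∧
      v = (List.replicate b z).flatten := by
  induction hn : u.length + v.length using Nat.strong_induction_on generalizing u v with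
  | _ n ih =>
    rcases eq_or_ne u [] with rfl | hu
    · exact ⟨v, 0, 1, by simp, by simp⟩
    rcases eq_or_ne v [] with rfl | hv
    · exact ⟨u, 1, 0, by simp, by simp⟩
    have hu' := List.length_pos_iff.2 hu
    have hv' := List.length_pos_iff.2 hv
    rcases List.append_eq_append_iff.1 h with ⟨s, rfl, h'⟩ | ⟨s, rfl, h'⟩
    · have hs : u ++ s = s ++ u := by simpa using h
      obtain ⟨z, a, b, ha, hb⟩ := ih (u.length + s.length) (by simp at hn; omega) u s hs rfl
      exact ⟨z, a, a + b, ha, by rw [List.replicate_add, List.flatten_append, ← ha, ← hb]⟩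
    · have hs : s ++ v = v ++ s := by simpa using h
      obtain ⟨z, a, b, ha, hb⟩ := ih (s.length + v.length) (by simp at hn; omega) s v hs rfl
      exact ⟨z, b + a, b, by rw [List.replicate_add, List.flatten_append, ← ha, ← hb], hb⟩

theorem IsPrimitiveWord.rotate_ne {A : Type*} {w : List A} (hw : IsPrimitiveWord w) {j : ℕ}
    (hj : 0 < j) (hjw : j < w.length) : w.rotate j ≠ w := by
  intro h
  rw [List.rotate_eq_drop_append_take hjw.le] at h
  have h' : w.take j ++ w.drop j = w.drop j ++ w.take j := by rw [h, List.take_append_drop]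
  obtain ⟨z, a, b, ha, hb⟩ := List.exists_replicate_of_append_comm _ _ h'
  have ha0 : a ≠ 0 := by
    rintro rfl
    have := congrArg List.length ha
    rw [List.length_take] at this
    simp only [List.replicate_zero, List.flatten_nil, List.length_nil] at this
    omega
  have hb0 : b ≠ 0 := by
    rintro rfl
    have := congrArg List.length hb
    rw [List.length_drop] at this
    simp only [List.replicate_zero, List.flatten_nil, List.length_nil] at this
    omega
  refine hw.2 z (a + b) (by omega) ?_
  rw [List.replicate_add, List.flatten_append, ← ha, ← hb, List.take_append_drop]

/-- The factor of `x` occupying the positions in `[a, b)`. -/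
def infiniteWordFactor {A : Type*} (x : ℕ → A) (a b : ℕ) : List A :=
  (List.range (b - a)).map fun i => x (a + i)

section Factor

variable {A : Type*} {x : ℕ → A} {a b c : ℕ}

@[simp] theorem length_infiniteWordFactor : (infiniteWordFactor x a b).length = b - a := by
  simp [infiniteWordFactor]

@[simp] theorem getElem_infiniteWordFactor {t : ℕ} (ht : t < (infiniteWordFactor x a b).length) :
    (infiniteWordFactor x a b)[t] = x (a + t) := by
  simp [infiniteWordFactor]

theorem infiniteWordFactor_append (hab : a ≤ b) (hbc : b ≤ c) :
    infiniteWordFactor x a b ++ infiniteWordFactor x b c = infiniteWordFactor x a c := by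
  apply List.ext_getElem
  · simp; omega
  · intro t h₁ h₂
    rw [List.getElem_append]
    split
    · simp
    · simp only [getElem_infiniteWordFactor, length_infiniteWordFactor]
      congr 1
      simp at *
      omega

variable [LinearOrder A]

theorem infiniteWordFactor_lt_iff {d : ℕ} :
    infiniteWordFactor x a b < infiniteWordFactor x c d ↔
      ((∀ s < b - a, x (a + s) = x (c + s)) ∧ b - a < d - c) ∨
        ∃ t, t < b - a ∧ t < d - c ∧ (∀ s < t, x (a + s) = x (c + s)) ∧ x (a + t) < x (c + t) := by
  rw [List.lt_iff_exists]
  apply or_congr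
  · simp only [length_infiniteWordFactor]
    refine and_congr_left fun hlt => ?_
    constructor
    · intro h s hs
      have := congrArg (fun l => l[s]?) h
      simpa [List.getElem?_eq_getElem, hs, hs.trans hlt] using this
    · intro h
      apply List.ext_getElem
      · simp; omega
      · intro t h₁ h₂
        simpa using h t (by simpa using h₁)
  · simp
    grind

/-- Replaces rotations by proper suffixes: `w` must beat each of them at a mismatch inside the
suffix, so a Lyndon word has no border. -/
theorem isLyndonWord_iff_getElem {w : List A} :
    IsLyndonWord w ↔ w ≠ [] ∧ ∀ j, 0 < j → j < w.length → ∃ (t : ℕ) (ht : j + t < w.length),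
      (∀ s (hs : s < t), w[s] = w[j + s]) ∧ w[t] < w[j + t] := by
  constructor
  · rintro ⟨hp, hmin⟩
    refine ⟨hp.1, fun j hj hjw => ?_⟩
    have hlt : ∀ i, 0 < i → i < w.length → w < w.rotate i := fun i hi hiw =>
      lt_of_le_of_ne (hmin _ ⟨i, rfl⟩) (hp.rotate_ne hi hiw).symm
    have := hlt j hj hjw
    rw [List.lt_iff_exists] at this
    rcases this with ⟨_, h⟩ | ⟨i, hi, _, heq, hi_lt⟩
    · simp at h
    simp only [List.getElem_rotate] at heq hi_lt
    by_cases hji : i + j < w.length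
    · refine ⟨i, by omega, fun s hs => ?_, ?_⟩
      · have := heq s hs
        simpa only [add_comm s j, Nat.mod_eq_of_lt (show j + s < w.length by omega)] using this
      · simpa only [add_comm i j, Nat.mod_eq_of_lt (show j + i < w.length by omega)] using hi_lt
    -- Now the suffix `v` at `j` is a border: `w = u ++ v = v ++ z`. From `w < v ++ u` follows `z <
    -- u`, so the rotation `z ++ v` is below `w`.
    · exfalso
      refine (hlt (w.length - j) (by omega) (by omega)).not_gt ?_
      rw [List.lt_iff_exists]
      have hmod : ∀ s, s + (w.length - j) < w.length →
          (s + (w.length - j) + j) % w.length = s := by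
        intro s hs
        rw [show s + (w.length - j) + j = s + w.length by omega, Nat.add_mod_right,
          Nat.mod_eq_of_lt (by omega)]
      refine Or.inr ⟨i + j - w.length, by simp; omega, by omega, fun s hs => ?_, ?_⟩
      · have := heq (s + (w.length - j)) (by omega)
        simp only [hmod s (by omega)] at this
        simp only [List.getElem_rotate, Nat.mod_eq_of_lt (show s + (w.length - j) < w.length by omega)]
        exact this
      · simp only [List.getElem_rotate,
          show i + j - w.length + (w.length - j) = i by omega, Nat.mod_eq_of_lt hi]
        convert hi_lt using 2
        rw [Nat.mod_eq_sub_mod (by omega), Nat.mod_eq_of_lt (by omega)]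
  · rintro ⟨hne, h⟩
    refine ⟨⟨hne, ?_⟩, ?_⟩
    · rintro u n hn rfl
      obtain ⟨m, rfl⟩ : ∃ m, n = m + 2 := ⟨n - 2, by omega⟩
      have hu : 0 < u.length := List.length_pos_iff.2 (by rintro rfl; simp at hne)
      have e₁ : (List.replicate (m + 2) u).flatten = u ++ (List.replicate (m + 1) u).flatten := by
        simp [List.replicate_succ]
      have e₂ : (List.replicate (m + 2) u).flatten = (List.replicate (m + 1) u).flatten ++ u := by
        simp [List.replicate_succ' (n := m + 1)]
      have hlen : (List.replicate (m + 2) u).flatten.length =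
          (List.replicate (m + 1) u).flatten.length + u.length := by
        rw [e₂, List.length_append]
      have hlen' : (List.replicate (m + 1) u).flatten.length = (m + 1) * u.length := by simp
      have hpos : 0 < (m + 1) * u.length := by positivity
      -- The last copy of `u` is both a suffix and a prefix, so no mismatch can occur.
      obtain ⟨t, ht, -, hlt⟩ := h (List.replicate (m + 1) u).flatten.length (by omega) (by omega)
      refine hlt.ne ?_
      have htu : t < u.length := by omega
      have h₁ : (List.replicate (m + 2) u).flatten[t]'(by omega) = u[t] := by
        simp only [e₁]
        rw [List.getElem_append_left htu]
      have h₂ : (List.replicate (m + 2) u).flatten[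
          (List.replicate (m + 1) u).flatten.length + t]'ht = u[t] := by
        simp only [e₂]
        rw [List.getElem_append_right (by omega)]
        simp
      rw [h₁, h₂]
    · rintro _ ⟨n, rfl⟩
      have hw := List.length_pos_iff.2 hne
      rw [← List.rotate_mod]
      rcases Nat.eq_zero_or_pos (n % w.length) with h0 | h0
      · rw [h0, List.rotate_zero]
      · have hn := Nat.mod_lt n hw
        obtain ⟨t, ht, heq, hlt⟩ := h _ h0 hn
        refine le_of_lt (List.lt_iff_exists.2 (Or.inr ⟨t, by omega, by simp; omega, ?_, ?_⟩))
        · intro s hs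
          rw [heq s hs, List.getElem_rotate]
          congr 1
          rw [Nat.mod_eq_of_lt (show s + n % w.length < w.length by omega), add_comm]
        · refine hlt.trans_eq ?_
          rw [List.getElem_rotate]
          congr 1
          rw [Nat.mod_eq_of_lt (show t + n % w.length < w.length by omega), add_comm]

theorem isLyndonWord_infiniteWordFactor_iff :
    IsLyndonWord (infiniteWordFactor x a b) ↔ a < b ∧ ∀ j, a < j → j < b →
      ∃ t, j + t < b ∧ (∀ s < t, x (a + s) = x (j + s)) ∧ x (a + t) < x (j + t) := by
  rw [isLyndonWord_iff_getElem, ← List.length_pos_iff]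
  simp only [length_infiniteWordFactor, getElem_infiniteWordFactor, tsub_pos_iff_lt]
  refine and_congr_right fun hab => ⟨fun h j haj hjb => ?_, fun h j hj hjb => ?_⟩
  · obtain ⟨t, ht, heq, hlt⟩ := h (j - a) (by omega) (by omega)
    have e : ∀ s, a + (j - a + s) = j + s := fun s => by omega
    simp only [e] at heq hlt
    exact ⟨t, by omega, heq, hlt⟩
  · obtain ⟨t, ht, heq, hlt⟩ := h (a + j) (by omega) (by omega)
    simp only [add_assoc] at heq hlt
    exact ⟨t, by omega, heq, hlt⟩

end Factor

/-! ### Factors between consecutive records -/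

section LexSuffix

variable {A : Type*} [LinearOrder A] {x : ℕ → A}

theorem lexSuffix_add_le {a b d : ℕ} (h : lexSuffix x a ≤ lexSuffix x b)
    (heq : ∀ s < d, x (a + s) = x (b + s)) : lexSuffix x (a + d) ≤ lexSuffix x (b + d) := by
  rw [← not_lt] at h ⊢
  refine fun hlt => h ?_
  obtain ⟨t, ht, hlt⟩ := lexSuffix_lt_iff.1 hlt
  refine lexSuffix_lt_iff.2 ⟨d + t, fun s hs => ?_, by simpa only [add_assoc] using hlt⟩
  rcases lt_or_ge s d with hsd | hsd
  · exact (heq s hsd).symm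
  · have := ht (s - d) (by omega)
    rwa [add_assoc, add_assoc, Nat.add_sub_cancel' hsd] at this

theorem lexSuffix_lt_trans_within {a b c t : ℕ}
    (hab : ∃ u ≤ t, (∀ s < u, x (a + s) = x (b + s)) ∧ x (a + u) < x (b + u))
    (hbc : ∃ u ≤ t, (∀ s < u, x (b + s) = x (c + s)) ∧ x (b + u) < x (c + u)) :
    ∃ u ≤ t, (∀ s < u, x (a + s) = x (c + s)) ∧ x (a + u) < x (c + u) := by
  obtain ⟨u, hu, hue, hul⟩ := hab
  obtain ⟨v, hv, hve, hvl⟩ := hbc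
  rcases lt_trichotomy u v with h | rfl | h
  · exact ⟨u, hu, fun s hs => (hue s hs).trans (hve s (hs.trans h)), hul.trans_eq (hve u h)⟩
  · exact ⟨u, hu, fun s hs => (hue s hs).trans (hve s hs), hul.trans hvl⟩
  · exact ⟨v, hv, fun s hs => (hue s (hs.trans h)).trans (hve s hs), (hue v h).trans_lt hvl⟩

/-- The first `j` after `a` violating this would itself be a record. -/
theorem lexSuffix_lt_of_not_mem_suffixRecords {a b j : ℕ} (ha : a ∈ suffixRecords x) (haj : a < j)
    (hjb : j < b) (h : ∀ i, a < i → i < b → i ∉ suffixRecords x) :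
    lexSuffix x a < lexSuffix x j := by
  induction j using Nat.strong_induction_on with
  | _ j ih =>
    by_contra! hle
    refine h j haj hjb fun i hi => ?_
    rcases lt_trichotomy i a with hia | rfl | hia
    · exact hle.trans (ha i hia)
    · exact hle
    · exact hle.trans (ih i hi hia (hi.trans hjb)).le

theorem isLyndonWord_of_suffixRecords {a b : ℕ} (hab : a < b) (ha : a ∈ suffixRecords x)
    (hb : b ∈ suffixRecords x) (h : ∀ i, a < i → i < b → i ∉ suffixRecords x) :
    IsLyndonWord (infiniteWordFactor x a b) := by
  refine isLyndonWord_infiniteWordFactor_iff.2 ⟨hab, fun j haj hjb => ?_⟩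
  have hlt := lexSuffix_lt_of_not_mem_suffixRecords ha haj hjb h
  obtain ⟨t, ht, htl⟩ := lexSuffix_lt_iff.1 hlt
  refine ⟨t, ?_, ht, htl⟩
  -- Without a mismatch before `b`, stripping `b - j` letters gives suffix `a + (b - j)` ≤ suffix
  -- `b` ≤ suffix `a`, though `a + (b - j)` lies strictly between the records.
  by_contra! hbt
  have hle := lexSuffix_add_le (d := b - j) hlt.le fun s hs => ht s (by omega)
  rw [Nat.add_sub_cancel' hjb.le] at hle
  exact (hle.trans (hb a hab)).not_gt
    (lexSuffix_lt_of_not_mem_suffixRecords ha (by omega) (by omega) h)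

theorem infiniteWordFactor_le_of_suffixRecords {a b c : ℕ} (hab : a < b)
    (hb : b ∈ suffixRecords x) (h : ∀ i, b < i → i < c → i ∉ suffixRecords x) :
    infiniteWordFactor x b c ≤ infiniteWordFactor x a b := by
  rw [← not_lt, infiniteWordFactor_lt_iff]
  rintro (⟨heq, hlt⟩ | ⟨t, -, -, heq, hlt⟩)
  · refine (lexSuffix_add_le (d := b - a) (hb a hab) fun s hs => (heq s hs).symm).not_gt ?_
    rw [Nat.add_sub_cancel' hab.le]
    exact lexSuffix_lt_of_not_mem_suffixRecords hb (by omega) (by omega) h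
  · exact (hb a hab).not_gt (lexSuffix_lt_iff.2 ⟨t, heq, hlt⟩)

end LexSuffix

theorem InfiniteWordLT.trans_le {A : Type*} [LinearOrder A] {y : ℕ → A} {u v : List A}
    (h : InfiniteWordLT y u) (huv : u ≤ v) : InfiniteWordLT y v := by
  rcases huv.eq_or_lt with rfl | huv
  · exact h
  obtain ⟨t, ht, heq, hlt⟩ := h
  rcases List.lt_iff_exists.1 huv with ⟨hp, hl⟩ | ⟨i, hi, hi', he, hl⟩
  · have hget : ∀ s (hs : s < u.length), u[s] = v[s] := by
      intro s hs
      have := congrArg (fun l => l[s]?) hp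
      simpa [List.getElem?_eq_getElem, hs, hs.trans hl] using this
    exact ⟨t, ht.trans hl, fun s hs => (heq s hs).trans (hget s _), hlt.trans_eq (hget t ht)⟩
  · rcases lt_trichotomy t i with h | rfl | h
    · exact ⟨t, h.trans hi', fun s hs => (heq s hs).trans (he s (hs.trans h)),
        hlt.trans_eq (he t h)⟩
    · exact ⟨t, hi', fun s hs => (heq s hs).trans (he s hs), hlt.trans hl⟩
    · exact ⟨i, hi', fun s hs => (heq s (hs.trans h)).trans (he s hs), (heq i h).trans_lt hl⟩

/-! ### Cuts of a Lyndon factorization are the records; uniqueness -/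

/-- `p 0, p 1, …` (up to index `r`) are the starting positions of a Lyndon factorization of `x`. -/
structure IsLyndonCuts {A : Type*} [LinearOrder A] (x : ℕ → A) (r : ℕ∞) (p : ℕ → ℕ) : Prop where
  zero : p 0 = 0
  isLyndonWord (n : ℕ) : n < r → IsLyndonWord (infiniteWordFactor x (p n) (p (n + 1)))
  antitone (i n : ℕ) : i < n → n < r →
    infiniteWordFactor x (p n) (p (n + 1)) ≤ infiniteWordFactor x (p i) (p (i + 1))
  last_lt (n : ℕ) : n = r → ∀ i < n,
    InfiniteWordLT (fun t => x (p n + t)) (infiniteWordFactor x (p i) (p (i + 1)))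
  last_lyndon (n : ℕ) : n = r → IsInfiniteLyndonWord fun t => x (p n + t)

theorem lt_of_lt_of_le_of_lt_succ {r : ℕ∞} {p : ℕ → ℕ} (h : ∀ n : ℕ, n < r → p n < p (n + 1))
    {i n : ℕ} (hin : i < n) (hn : (n : ℕ∞) ≤ r) : p i < p n := by
  induction n, hin using Nat.le_induction with
  | base => exact h i ((Nat.cast_lt.2 (Nat.lt_succ_self i)).trans_le hn)
  | succ n hin ih =>
    have := (Nat.cast_lt.2 (Nat.lt_add_one n)).trans_le hn
    exact (ih this.le).trans (h n this)

namespace IsLyndonCuts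

variable {A : Type*} [LinearOrder A] {x : ℕ → A} {r r' : ℕ∞} {p q : ℕ → ℕ}

theorem coe_lt_of_lt_of_le {i n : ℕ} (h : i < n) (hn : (n : ℕ∞) ≤ r) : (i : ℕ∞) < r :=
  (Nat.cast_lt.2 h).trans_le hn

theorem lt_succ (h : IsLyndonCuts x r p) {n : ℕ} (hn : (n : ℕ∞) < r) : p n < p (n + 1) :=
  (isLyndonWord_infiniteWordFactor_iff.1 (h.isLyndonWord n hn)).1

theorem strictMono (h : IsLyndonCuts x r p) {i n : ℕ} (hin : i < n) (hn : (n : ℕ∞) ≤ r) :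
    p i < p n :=
  lt_of_lt_of_le_of_lt_succ (fun _ => h.lt_succ) hin hn

theorem exists_block (h : IsLyndonCuts x r p) (m : ℕ) :
    ∃ n : ℕ, n ≤ r ∧ p n ≤ m ∧ (n < r → m < p (n + 1)) := by
  induction m with
  | zero => exact ⟨0, by simp, h.zero.le, fun hr => by simpa [h.zero] using h.lt_succ hr⟩
  | succ m ih =>
    obtain ⟨n, hnr, hnm, hlt⟩ := ih
    by_cases hn : n < r ∧ p (n + 1) = m + 1
    · have hle : ((n + 1 : ℕ) : ℕ∞) ≤ r := by
        simpa using Order.add_one_le_of_lt hn.1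
      exact ⟨n + 1, hle, hn.2.le, fun hr => hn.2 ▸ h.lt_succ hr⟩
    · exact ⟨n, hnr, by omega, fun hr => by have := hlt hr; grind⟩

theorem lexSuffix_lt_of_mem_block (h : IsLyndonCuts x r p) {n m : ℕ} (hnr : (n : ℕ∞) ≤ r)
    (hm : p n < m) (hlt : n < r → m < p (n + 1)) : lexSuffix x (p n) < lexSuffix x m := by
  rcases hnr.lt_or_eq with hr | hr
  · obtain ⟨t, -, ht⟩ := (isLyndonWord_infiniteWordFactor_iff.1 (h.isLyndonWord n hr)).2 m hm (hlt hr)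
    exact lexSuffix_lt_iff.2 ⟨t, ht⟩
  · have := h.last_lyndon n hr (m - p n) (by omega)
    have e : ∀ t, p n + (m - p n + t) = m + t := fun t => by omega
    simp only [e] at this
    exact this

/-- A violation with first mismatch at `t` cannot lie within the `n`-th term, since the terms are
nonincreasing. Removing that term yields a violation with a smaller mismatch, so strong induction on
`t` applies. -/
theorem lexSuffix_le (h : IsLyndonCuts x r p) {i n : ℕ} (hin : i < n) (hnr : (n : ℕ∞) ≤ r) :
    lexSuffix x (p n) ≤ lexSuffix x (p i) := by
  rw [← not_lt, lexSuffix_lt_iff]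
  rintro ⟨t, heq, hlt⟩
  induction t using Nat.strong_induction_on generalizing i n with
  | _ t ih =>
    rcases hnr.lt_or_eq with hr | hr
    · have hwle := h.antitone i n hin hr
      rw [← not_lt, infiniteWordFactor_lt_iff, not_or] at hwle
      obtain ⟨hpre, hmis⟩ := hwle
      have hi := h.lt_succ (coe_lt_of_lt_of_le hin hnr)
      have hn := h.lt_succ hr
      have hsucc : ((n + 1 : ℕ) : ℕ∞) ≤ r := by simpa using Order.add_one_le_of_lt hr
      by_cases htn : t < p (n + 1) - p n
      · by_cases hti : t < p (i + 1) - p i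
        · exact hmis ⟨t, hti, htn, heq, hlt⟩
        · exact hpre ⟨fun s hs => heq s (by omega), by omega⟩
      · set b := p (n + 1) - p n with hb
        have hshift : ∀ s, p n + (b + s) = p (n + 1) + s := fun s => by omega
        have heq' : ∀ s < t - b, x (p i + b + s) = x (p (n + 1) + s) := by
          intro s hs
          have := heq (b + s) (by omega)
          rwa [hshift, ← add_assoc] at this
        have hlt' : x (p i + b + (t - b)) < x (p (n + 1) + (t - b)) := by
          rwa [← hshift, add_assoc, Nat.add_sub_cancel' (by omega)]
        rcases lt_trichotomy (p (i + 1) - p i) b with hlen | hlen | hlen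
        · exact hpre ⟨fun s hs => heq s (by omega), hlen⟩
        · have e : p i + b = p (i + 1) := by omega
          rw [e] at hlt'
          simp only [e] at heq'
          exact ih (t - b) (by omega) (Nat.succ_lt_succ hin) hsucc heq' hlt'
        -- The `n`-th term is a proper prefix of the `i`-th. As the latter is Lyndon, its start is
        -- below position `p i + b`, so `p i` can stand in for `p i + b` against `p (n + 1)`.
        · obtain ⟨u, hu, hu'⟩ := (isLyndonWord_infiniteWordFactor_iff.1
            (h.isLyndonWord i (coe_lt_of_lt_of_le hin hnr))).2 (p i + b) (by omega) (by omega)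
          by_cases hut : u ≤ t - b
          · obtain ⟨v, hv, hve, hvl⟩ := lexSuffix_lt_trans_within (t := t - b) ⟨u, hut, hu'⟩
              ⟨t - b, le_rfl, heq', hlt'⟩
            exact ih v (by omega) (hin.trans (Nat.lt_succ_self n)) hsucc hve hvl
          · refine ih (t - b) (by omega) (hin.trans (Nat.lt_succ_self n)) hsucc ?_ ?_
            · exact fun s hs => (hu'.1 s (by omega)).trans (heq' s hs)
            · exact (hu'.1 _ (by omega)).trans_lt hlt'
    · obtain ⟨u, hu, hue, hul⟩ := h.last_lt n hr i hin
      simp only [getElem_infiniteWordFactor] at hue hul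
      have h₁ : lexSuffix x (p n) < lexSuffix x (p i) := lexSuffix_lt_iff.2 ⟨u, hue, hul⟩
      exact h₁.not_gt (lexSuffix_lt_iff.2 ⟨t, heq, hlt⟩)

theorem mem_suffixRecords_iff (h : IsLyndonCuts x r p) {m : ℕ} :
    m ∈ suffixRecords x ↔ ∃ n : ℕ, n ≤ r ∧ p n = m := by
  constructor
  · intro hm
    obtain ⟨n, hnr, hnm, hlt⟩ := h.exists_block m
    refine ⟨n, hnr, ?_⟩
    by_contra hne
    have hlt' : p n < m := lt_of_le_of_ne hnm hne
    exact (hm _ hlt').not_gt (h.lexSuffix_lt_of_mem_block hnr hlt' hlt)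
  · rintro ⟨n, hnr, rfl⟩ j hj
    obtain ⟨i, hir, hij, hlt⟩ := h.exists_block j
    have hin : i < n := by
      by_contra! hni
      rcases hni.eq_or_lt with rfl | hni
      · omega
      · have := h.strictMono hni hir
        omega
    refine (h.lexSuffix_le hin hnr).trans ?_
    rcases hij.eq_or_lt with rfl | hij
    · exact le_rfl
    · exact (h.lexSuffix_lt_of_mem_block hir hij hlt).le

theorem le_of_le (hp : IsLyndonCuts x r p) (hq : IsLyndonCuts x r' q) {n : ℕ}
    (hnr : ((n + 1 : ℕ) : ℕ∞) ≤ r) (hn : (n : ℕ∞) ≤ r') (hpq : p n = q n) :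
    ((n + 1 : ℕ) : ℕ∞) ≤ r' ∧ q (n + 1) ≤ p (n + 1) := by
  obtain ⟨m, hm, hm'⟩ := hq.mem_suffixRecords_iff.1 (hp.mem_suffixRecords_iff.2 ⟨n + 1, hnr, rfl⟩)
  have hlt := hp.strictMono (Nat.lt_add_one n) hnr
  have hnm : n + 1 ≤ m := by
    by_contra! hmn
    rcases (Nat.lt_succ_iff.1 hmn).eq_or_lt with rfl | hmn
    · omega
    · have := hq.strictMono hmn hn
      omega
  refine ⟨(Nat.cast_le.2 hnm).trans hm, ?_⟩
  rcases hnm.eq_or_lt with rfl | hnm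
  · exact hm'.le
  · exact ((hq.strictMono hnm hm).trans_eq hm').le

theorem eq_of_le (hp : IsLyndonCuts x r p) (hq : IsLyndonCuts x r' q) {n : ℕ} (hn : (n : ℕ∞) ≤ r) :
    (n : ℕ∞) ≤ r' ∧ p n = q n := by
  induction n with
  | zero => exact ⟨by simp, hp.zero.trans hq.zero.symm⟩
  | succ n ih =>
    have hn' := (coe_lt_of_lt_of_le (Nat.lt_succ_self n) hn).le
    obtain ⟨h₁, h₂⟩ := ih hn'
    obtain ⟨h₃, h₄⟩ := hp.le_of_le hq hn h₁ h₂
    exact ⟨h₃, le_antisymm (hq.le_of_le hp h₃ hn' h₂.symm).2 h₄⟩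

theorem length_eq (hp : IsLyndonCuts x r p) (hq : IsLyndonCuts x r' q) : r = r' :=
  le_antisymm (ENat.forall_natCast_le_iff_le.1 fun _ h => (hp.eq_of_le hq h).1)
    (ENat.forall_natCast_le_iff_le.1 fun _ h => (hq.eq_of_le hp h).1)

end IsLyndonCuts

/-! ### Existence: cutting at the records -/

theorem exists_enumeration {S : Set ℕ} (h0 : 0 ∈ S) :
    ∃ (r : ℕ∞) (p : ℕ → ℕ), p 0 = 0 ∧ (∀ n : ℕ, n < r → p n < p (n + 1)) ∧
      ∀ m, m ∈ S ↔ ∃ n : ℕ, n ≤ r ∧ p n = m := by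
  classical
  rcases S.finite_or_infinite with hS | hS
  · have hS' : (Set.ofPred (· ∈ S)).Finite := hS
    have hpos : 0 < hS'.toFinset.card := Finset.card_pos.2 ⟨0, by simpa using h0⟩
    -- The index `r` is that of the last element, hence the cardinality minus one.
    refine ⟨((hS'.toFinset.card - 1 : ℕ) : ℕ∞), Nat.nth (· ∈ S), Nat.nth_zero_of_zero h0, ?_, ?_⟩
    · intro n hn
      have hn : n < hS'.toFinset.card - 1 := by exact_mod_cast hn
      exact Nat.nth_strictMonoOn hS' (Set.mem_Iio.2 (by omega)) (Set.mem_Iio.2 (by omega))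
        (Nat.lt_succ_self n)
    · intro m
      constructor
      · intro hm
        obtain ⟨n, hn, rfl⟩ := Nat.exists_lt_card_finite_nth_eq hS' hm
        exact ⟨n, by exact_mod_cast (by omega : n ≤ hS'.toFinset.card - 1), rfl⟩
      · rintro ⟨n, hn, rfl⟩
        have hn : n ≤ hS'.toFinset.card - 1 := by exact_mod_cast hn
        exact Nat.nth_mem_of_lt_card hS' (by omega)
  · have hS' : (Set.ofPred (· ∈ S)).Infinite := hS
    refine ⟨⊤, Nat.nth (· ∈ S), Nat.nth_zero_of_zero h0,
      fun n _ => Nat.nth_strictMono hS' (Nat.lt_succ_self n), fun m => ⟨fun hm => ?_, ?_⟩⟩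
    · obtain ⟨n, -, hn⟩ := Nat.exists_lt_card_nth_eq (p := (· ∈ S)) hm
      exact ⟨n, le_top, hn⟩
    · rintro ⟨n, -, rfl⟩
      exact Nat.nth_mem_of_infinite hS' n

theorem infiniteWordLT_of_lexSuffix_le {A : Type*} [LinearOrder A] {x : ℕ → A} {a b : ℕ}
    (hab : a < b) (hle : lexSuffix x b ≤ lexSuffix x a)
    (hb : ∀ j, b < j → lexSuffix x b < lexSuffix x j) :
    InfiniteWordLT (fun t => x (b + t)) (infiniteWordFactor x a b) := by
  classical
  -- Otherwise stripping the whole factor puts a later suffix at or below the one at `b`.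
  have hne : ∃ s, x (b + s) ≠ x (a + s) ∧ s < b - a := by
    by_contra! h
    have := lexSuffix_add_le (d := b - a) hle fun s hs => by
      by_contra hs'
      exact (h s hs').not_gt hs
    rw [Nat.add_sub_cancel' hab.le] at this
    exact this.not_gt (hb _ (by omega))
  obtain ⟨hs, hsb⟩ := Nat.find_spec hne
  have hmin : ∀ s < Nat.find hne, x (b + s) = x (a + s) := fun s hs => by
    by_contra h
    exact Nat.find_min hne hs ⟨h, hs.trans hsb⟩
  refine ⟨Nat.find hne, by simpa using hsb, fun s hs => by simpa using hmin s hs, ?_⟩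
  rw [getElem_infiniteWordFactor]
  refine lt_of_le_of_ne (le_of_not_gt fun hlt => hle.not_gt ?_) hs
  exact lexSuffix_lt_iff.2 ⟨_, fun s hs => (hmin s hs).symm, hlt⟩

theorem exists_isLyndonCuts {A : Type*} [LinearOrder A] (x : ℕ → A) :
    ∃ (r : ℕ∞) (p : ℕ → ℕ), IsLyndonCuts x r p := by
  obtain ⟨r, p, h0, hlt, hS⟩ := exists_enumeration (S := suffixRecords x) (fun j hj => by omega)
  have hmono : ∀ i n : ℕ, i < n → (n : ℕ∞) ≤ r → p i < p n := fun i n =>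
    lt_of_lt_of_le_of_lt_succ hlt
  have hmem : ∀ n : ℕ, (n : ℕ∞) ≤ r → p n ∈ suffixRecords x := fun n hn => (hS _).2 ⟨n, hn, rfl⟩
  have hsucc : ∀ n : ℕ, (n : ℕ∞) < r → ((n + 1 : ℕ) : ℕ∞) ≤ r := fun n hn => by
    simpa using Order.add_one_le_of_lt hn
  have hgap : ∀ n : ℕ, (n : ℕ∞) < r → ∀ j, p n < j → j < p (n + 1) → j ∉ suffixRecords x := by
    rintro n hn j hj hj' hjS
    obtain ⟨m, hm, rfl⟩ := (hS j).1 hjS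
    rcases lt_or_ge n m with hnm | hnm
    · rcases (show n + 1 ≤ m from hnm).eq_or_lt with rfl | hnm
      · omega
      · have := hmono _ _ hnm hm
        omega
    · rcases hnm.eq_or_lt with rfl | hnm
      · omega
      · have := hmono _ _ hnm hn.le
        omega
  have hlast : ∀ n : ℕ, (n : ℕ∞) = r → ∀ j, p n < j → lexSuffix x (p n) < lexSuffix x j := by
    intro n hn j hj
    refine lexSuffix_lt_of_not_mem_suffixRecords (hmem n hn.le) hj (Nat.lt_succ_self j) ?_
    intro i hi _ hiS
    obtain ⟨m, hm, rfl⟩ := (hS i).1 hiS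
    rw [← hn, Nat.cast_le] at hm
    rcases hm.eq_or_lt with rfl | hm
    · omega
    · have := hmono _ _ hm hn.le
      omega
  have hstep : ∀ n : ℕ, ((n + 1 : ℕ) : ℕ∞) < r →
      infiniteWordFactor x (p (n + 1)) (p (n + 1 + 1)) ≤ infiniteWordFactor x (p n) (p (n + 1)) :=
    fun n hn => infiniteWordFactor_le_of_suffixRecords (hmono _ _ (Nat.lt_succ_self n) hn.le)
      (hmem _ hn.le) (hgap _ hn)
  refine ⟨r, p, h0, fun n hn => isLyndonWord_of_suffixRecords (hlt n hn) (hmem _ hn.le)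
    (hmem _ (hsucc n hn)) (hgap n hn), fun i n hin hn => ?_, fun n hn i hi => ?_,
    fun n hn j hj => ?_⟩
  · induction n, hin using Nat.le_induction with
    | base => exact hstep i hn
    | succ n hin ih => exact (hstep n hn).trans (ih ((Nat.cast_lt.2 (Nat.lt_succ_self n)).trans hn))
  -- Only the last finite term is compared with the infinite one directly; earlier terms follow by
  -- monotonicity.
  · obtain ⟨d, rfl⟩ := Nat.exists_eq_add_of_lt hi
    clear hi
    induction d generalizing i with
    | zero =>
      have hi := hlt i (hn ▸ Nat.cast_lt.2 (by omega))
      exact infiniteWordLT_of_lexSuffix_le hi (hmem _ hn.le _ hi) (hlast _ hn)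
    | succ d ih =>
      have e : i + 1 + d + 1 = i + (d + 1) + 1 := by omega
      have := ih (i + 1) (e ▸ hn)
      rw [e] at this
      exact this.trans_le (hstep i (hn ▸ Nat.cast_lt.2 (by omega)))
  · have := hlast n hn (p n + j) (by omega)
    unfold lexSuffix at this
    simp only [add_assoc] at this
    exact this

/-! ### Translation between cuts and factorizations -/

section Factorization

variable {A : Type*} {x : ℕ → A} {r : ℕ∞} {p : ℕ → ℕ}

/-- The factorization of `x` whose terms start at `p 0, p 1, …` (up to index `r`). -/
noncomputable def cutsFactorization (x : ℕ → A) (r : ℕ∞) (p : ℕ → ℕ) : Factorization A :=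
  ENat.recTopCoe (.infinite fun n => infiniteWordFactor x (p n) (p (n + 1)))
    (fun r => .finite ((List.range r).map fun n => infiniteWordFactor x (p n) (p (n + 1)))
      fun t => x (p r + t)) r

theorem cutsFactorization_congr {q : ℕ → ℕ} (h : ∀ n : ℕ, n ≤ r → p n = q n) :
    cutsFactorization x r p = cutsFactorization x r q := by
  induction r using ENat.recTopCoe with
  | top =>
    have : p = q := funext fun n => h n le_top
    rw [this]
  | coe r =>
    have h : ∀ n ≤ r, p n = q n := fun n hn => h n (Nat.cast_le.2 hn)
    simp only [cutsFactorization, ENat.recTopCoe_natCast, h r le_rfl, Factorization.finite.injEq,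
      and_true]
    refine List.map_congr_left fun n hn => ?_
    have hn := List.mem_range.1 hn
    rw [h n hn.le, h (n + 1) hn]

variable [LinearOrder A]

theorem IsLyndonCuts.sum_length (h : IsLyndonCuts x r p) {n : ℕ} (hn : (n : ℕ∞) ≤ r) :
    ∑ i ∈ Finset.range n, (infiniteWordFactor x (p i) (p (i + 1))).length = p n := by
  induction n with
  | zero => simp [h.zero]
  | succ n ih =>
    have hlt := coe_lt_of_lt_of_le (Nat.lt_succ_self n) hn
    have := h.lt_succ hlt
    rw [Finset.sum_range_succ, ih hlt.le, length_infiniteWordFactor]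
    omega

theorem IsLyndonCuts.flatten_eq (h : IsLyndonCuts x r p) {n : ℕ} (hn : (n : ℕ∞) ≤ r) :
    ((List.range n).map fun i => infiniteWordFactor x (p i) (p (i + 1))).flatten =
      infiniteWordFactor x 0 (p n) := by
  induction n with
  | zero => simp [h.zero, infiniteWordFactor]
  | succ n ih =>
    have hlt := coe_lt_of_lt_of_le (Nat.lt_succ_self n) hn
    rw [List.range_succ, List.map_append, List.flatten_append, ih hlt.le]
    simpa using infiniteWordFactor_append (Nat.zero_le _) (h.lt_succ hlt).le

theorem IsLyndonCuts.starts_eq (h : IsLyndonCuts x r p) :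
    (cutsFactorization x r p).starts = suffixRecords x := by
  ext m
  rw [h.mem_suffixRecords_iff]
  induction r using ENat.recTopCoe with
  | top =>
    simp only [cutsFactorization, ENat.recTopCoe_top, Factorization.starts, Set.mem_ofPred_eq]
    refine exists_congr fun n => ?_
    rw [h.sum_length le_top]
    simp [eq_comm]
  | coe r =>
    simp only [cutsFactorization, ENat.recTopCoe_natCast, Factorization.starts, Set.mem_ofPred_eq,
      List.length_map, List.length_range, Nat.cast_le]
    refine exists_congr fun n => and_congr_right fun hn => ?_
    rw [← List.map_take, List.take_range, min_eq_left hn, h.flatten_eq (Nat.cast_le.2 hn)]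
    simp [eq_comm]

theorem IsLyndonCuts.isLyndonOf (h : IsLyndonCuts x r p) :
    (cutsFactorization x r p).IsLyndonOf x := by
  induction r using ENat.recTopCoe with
  | top =>
    refine ⟨fun n => h.isLyndonWord n (ENat.natCast_lt_top n),
      fun n => h.antitone n (n + 1) (Nat.lt_succ_self n) (ENat.natCast_lt_top _), fun n t ht => ?_⟩
    rw [h.sum_length le_top, getElem_infiniteWordFactor]
  | coe r =>
    refine ⟨?_, h.last_lyndon r rfl, ?_, ?_, ?_, ?_⟩
    · simp only [List.mem_map, List.mem_range]
      rintro _ ⟨n, hn, rfl⟩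
      exact h.isLyndonWord n (Nat.cast_lt.2 hn)
    · rw [List.pairwise_map]
      refine (List.pairwise_lt_range (n := r)).imp_of_mem fun {i n} _ hn hin => ?_
      exact h.antitone i n hin (Nat.cast_lt.2 (List.mem_range.1 hn))
    · simp only [List.mem_map, List.mem_range]
      rintro _ ⟨n, hn, rfl⟩
      exact h.last_lt r rfl n hn
    · rw [h.flatten_eq le_rfl]
      simp
    · rw [h.flatten_eq le_rfl]
      simp

theorem Factorization.IsLyndonOf.exists_cuts {F : Factorization A} (hF : F.IsLyndonOf x) :
    ∃ (r : ℕ∞) (p : ℕ → ℕ), IsLyndonCuts x r p ∧ F = cutsFactorization x r p := by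
  cases F with
  | infinite w =>
    obtain ⟨hL, hanti, hx⟩ := hF
    have hw : ∀ n, w n = infiniteWordFactor x (∑ i ∈ Finset.range n, (w i).length)
        (∑ i ∈ Finset.range (n + 1), (w i).length) := by
      intro n
      apply List.ext_getElem
      · simp [Finset.sum_range_succ]
      · intro t h₁ h₂
        rw [getElem_infiniteWordFactor, hx]
    refine ⟨⊤, fun n => ∑ i ∈ Finset.range n, (w i).length, ⟨by simp, fun n _ => ?_,
      fun i n hin _ => ?_, fun n hn => by simp at hn, fun n hn => by simp at hn⟩, ?_⟩
    · rw [← hw]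
      exact hL n
    · rw [← hw, ← hw]
      exact antitone_nat_of_succ_le hanti hin.le
    · simp only [cutsFactorization, ENat.recTopCoe_top, ← hw]
  | finite ws y =>
    obtain ⟨hL, hy, hanti, hlt, hx, hxy⟩ := hF
    have hw : ∀ n (hn : n < ws.length), ws[n] =
        infiniteWordFactor x (ws.take n).flatten.length (ws.take (n + 1)).flatten.length := by
      intro n hn
      have hsplit : ws.flatten =
          (ws.take n).flatten ++ (ws[n] ++ (ws.drop (n + 1)).flatten) := by
        have : ws = ws.take n ++ ws[n] :: ws.drop (n + 1) := by simp
        rw [← List.flatten_cons, ← List.flatten_append, ← this]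
      apply List.ext_getElem
      · rw [length_infiniteWordFactor, List.take_add_one, List.getElem?_eq_getElem hn,
          List.flatten_append, List.length_append, Nat.add_sub_cancel_left]
        simp
      · intro t h₁ h₂
        have hlen := congrArg List.length hsplit
        rw [List.length_append, List.length_append] at hlen
        rw [getElem_infiniteWordFactor, hx _ (by omega)]
        simp only [hsplit]
        rw [List.getElem_append_right (by omega), List.getElem_append_left (by omega)]
        simp
    have hy' : (fun t => x (ws.flatten.length + t)) = y := funext hxy
    refine ⟨ws.length, fun n => (ws.take n).flatten.length, ⟨by simp, fun n hn => ?_,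
      fun i n hin hn => ?_, fun n hn i hi => ?_, fun n hn => ?_⟩, ?_⟩
    · rw [← hw n (Nat.cast_lt.1 hn)]
      exact hL _ (List.getElem_mem _)
    · have hn := Nat.cast_lt.1 hn
      rw [← hw n hn, ← hw i (hin.trans hn)]
      exact List.pairwise_iff_getElem.1 hanti i n _ _ hin
    · obtain rfl := Nat.cast_injective hn
      rw [← hw i hi, List.take_length, hy']
      exact hlt _ (List.getElem_mem _)
    · obtain rfl := Nat.cast_injective hn
      rw [List.take_length, hy']
      exact hy
    · simp only [cutsFactorization, ENat.recTopCoe_natCast, List.take_length, hy',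
        Factorization.finite.injEq, and_true]
      apply List.ext_getElem
      · simp
      · intro n h₁ h₂
        simp [hw n h₁]

end Factorization

theorem theorem10 {A : Type*} [LinearOrder A] (k : ℕ) (hk : 2 ≤ k) (x : ℕ → A)
    (hx : IsAutomatic k x) :
    (∃! F : Factorization A, F.IsLyndonOf x) ∧
      ∀ F : Factorization A, F.IsLyndonOf x → IsAutomatic k F.encoding := by
  constructor
  · obtain ⟨r, p, hp⟩ := exists_isLyndonCuts x
    refine ⟨cutsFactorization x r p, hp.isLyndonOf, fun F hF => ?_⟩
    obtain ⟨r', q, hq, rfl⟩ := hF.exists_cuts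
    obtain rfl := hp.length_eq hq
    exact cutsFactorization_congr fun n hn => (hq.eq_of_le hp hn).2
  · intro F hF
    obtain ⟨r, p, hp, rfl⟩ := hF.exists_cuts
    unfold Factorization.encoding
    rw [hp.starts_eq]
    exact isAutomatic_suffixRecords hk hx
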